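/- For $n\ge 1$ let $p_n$ be the number of generalized partitions of $n$, i.e. of finite multisets $\{(v_1,w_1),\dots,(v_k,w_k)\}$ of pairs of positive integers with $\sum_{i=1}^k v_iw_i=n$. Let $d(\ell)$ be the number of positive divisors of $\ell$, and for integers $m\ge -1$ and real $\omega>0$ put $$S_m(\omega)=\sum_{k\ge 1}\sum_{\ell\mid k}\ell\, d(\ell)\,k^m e^{-k/\omega}.$$ These series converge absolutely; for every integer $n\ge 1$ the equation $S_0(\omega)=n$ has a unique solution $\omega=\omega(n)$ in $(0,\infty)$; and, as $n\to\infty$, $$p_n\sim\frac{1}{\sqrt{2\pi S_1(\omega)}}\exp\left(S_{-1}(\omega)+\frac n\omega\right),\qquad \omega=\omega(n),$$ where $a_n\sim b_n$ means $\lim_{n\to\infty}a_n/b_n=1$. -/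

import Mathlib

namespace GeneralizedPartition

/-- A generalized partition of `n`: a word `v₁^{w₁} ⋯ v_k^{w_k}` with positive integers `v_i, w_i`
and `∑ v_i w_i = n`, considered up to permutation of its letters `(v_i, w_i)`, that is, a finite
multiset of pairs of positive integers. -/
def IsGenPartition (n : ℕ) (s : Multiset (ℕ × ℕ)) : Prop :=
  (∀ x ∈ s, 0 < x.1 ∧ 0 < x.2) ∧ (s.map fun x => x.1 * x.2).sum = n

/-- The number `p_n` of generalized partitions of `n`. -/
noncomputable def p (n : ℕ) : ℕ := {s : Multiset (ℕ × ℕ) | IsGenPartition n s}.ncard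

/-- The `k`-th term `∑_{ℓ ∣ k} ℓ d(ℓ) k^m e^{-k/ω}` of the series `S_m(ω)`, where `d(ℓ)` is the
number of divisors of `ℓ`. For `k = 0` the sum is empty, so the term is `0`. -/
noncomputable def term (m : ℤ) (ω : ℝ) (k : ℕ) : ℝ :=
  ∑ l ∈ k.divisors, (l : ℝ) * (l.divisors.card : ℝ) * (k : ℝ) ^ m * Real.exp (-(k : ℝ) / ω)

/-- `S_m(ω) = ∑_{k ≥ 1} ∑_{ℓ ∣ k} ℓ d(ℓ) k^m e^{-k/ω}`. -/
noncomputable def S (m : ℤ) (ω : ℝ) : ℝ := ∑' k : ℕ, term m ω k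

end GeneralizedPartition

/-!
The argument is a saddle point analysis, carried out for multisets over any alphabet with a weight
`w`. Let `b n` be the number of multisets of total weight `n` and let `a k` be the sum of the
weights of all letters whose weight divides `k`. Counting copies of letters in two ways gives
`n * b n = ∑ a k * b (n - k)`, so the `b n` are the Taylor coefficients of
`exp (∑ (a k / k) z ^ k)`.

Cauchy's formula on the circle of radius `e ^ (-1 / ω)` with `S₀(ω) = n` expresses `b n` as
`e ^ (S₋₁ + n / ω)` times the mean of `exp (logChar a ω θ)`, where `logChar a ω θ` has the Taylor
polynomial `-S₁ θ² / 2` and cubic remainder `O(S₂ |θ|³)`. For `|θ| ≤ S₁ / (16 S₂)` the quadratic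
term dominates and the integral is asymptotically Gaussian. On the remaining arc, `k ≤ a k` bounds
the real part of `logChar a ω θ` by an explicit geometric sum, which makes the contribution
exponentially small. Both estimates need `S_m(ω) = O(ω ^ (m + s))` with `s < 5 / 2`, that is,
convergence of the Dirichlet series of `a` at some `s < 5 / 2`.
-/

namespace GeneralizedPartition

open Filter Topology
open Complex (I)
open scoped Real

/-! ### Dirichlet series of divisor sums -/

theorem lseriesSummable_ofReal_iff {f : ℕ → ℝ} {s : ℝ} (hs : s ≠ 0) :
    LSeriesSummable (fun n ↦ (f n : ℂ)) s ↔ Summable fun n ↦ f n * (n : ℝ) ^ (-s) := by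
  rw [LSeriesSummable, ← summable_norm_iff, ← summable_norm_iff (f := fun n ↦ f n * _)]
  refine summable_congr fun n ↦ ?_
  rcases Nat.eq_zero_or_pos n with rfl | hn
  · simp [hs]
  · rw [LSeries.norm_term_eq, if_neg hn.ne', norm_mul, Complex.norm_real, Complex.ofReal_re,
      Real.norm_of_nonneg (by positivity : 0 ≤ (n : ℝ) ^ (-s)), Real.rpow_neg n.cast_nonneg,
      div_eq_mul_inv]

theorem one_lt_of_summable_mul_rpow {f : ℕ → ℝ} {s : ℝ} (hf : ∀ k ≠ 0, 1 ≤ f k)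
    (hsum : Summable fun k : ℕ ↦ f k * (k : ℝ) ^ (-s)) : 1 < s := by
  have hshift : Summable fun k : ℕ ↦ ((k + 1 : ℕ) : ℝ) ^ (-s) :=
    .of_nonneg_of_le (fun k ↦ by positivity)
      (fun k ↦ le_mul_of_one_le_left (by positivity) (hf (k + 1) k.succ_ne_zero))
      ((summable_nat_add_iff 1).2 hsum)
  exact neg_lt_neg_iff.1
    (Real.summable_nat_rpow.1 ((summable_nat_add_iff (f := fun k : ℕ ↦ (k : ℝ) ^ (-s)) 1).1 hshift))

theorem summable_sum_divisors_mul_rpow {f : ℕ → ℝ} {s : ℝ} (hs : 1 < s)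
    (hf : Summable fun l ↦ f l * (l : ℝ) ^ (-s)) :
    Summable fun k : ℕ ↦ (∑ l ∈ k.divisors, f l) * (k : ℝ) ^ (-s) := by
  have hs0 : s ≠ 0 := by linarith
  have hone : LSeriesSummable (fun _ ↦ ((1 : ℝ) : ℂ)) s :=
    (lseriesSummable_ofReal_iff hs0).2 <| by
      simpa only [one_mul] using Real.summable_nat_rpow.2 (neg_lt_neg hs)
  rw [← lseriesSummable_ofReal_iff hs0]
  refine (LSeriesSummable_congr s fun {k} _ ↦ ?_).1
    (((lseriesSummable_ofReal_iff hs0).2 hf).convolution hone)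
  rw [LSeries.convolution_def]
  simp only [Complex.ofReal_one, mul_one, Nat.sum_divisorsAntidiagonal fun i _ ↦ (f i : ℂ),
    Complex.ofReal_sum]

/-! ### Multisets of given weight -/

section WeightedMultisets

variable {α : Type*}

/-- The multisets of total weight `n` whose letters have positive weight under `w`. Letters of
weight `0` are excluded, as they could be repeated without changing the total weight. -/
def multisetsOfWeight (w : α → ℕ) (n : ℕ) : Set (Multiset α) :=
  {s | (∀ x ∈ s, 0 < w x) ∧ (s.map w).sum = n}

/-- The number of letters of weight `l`, with the junk value `0` if there are infinitely many. -/
noncomputable def levelCount (w : α → ℕ) (l : ℕ) : ℕ := (w ⁻¹' {l}).ncard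

/-- The sum of `l * levelCount w l` over the divisors `l` of `k`. These are the coefficients of the
logarithmic derivative of the generating function of `(multisetsOfWeight w n).ncard`. -/
noncomputable def divisorWeight (w : α → ℕ) (k : ℕ) : ℕ := ∑ l ∈ k.divisors, l * levelCount w l

variable {w : α → ℕ} {n : ℕ} {s : Multiset α}

theorem weight_mem_Icc (hs : s ∈ multisetsOfWeight w n) {x : α} (hx : x ∈ s) :
    w x ∈ Set.Icc 1 n :=
  ⟨hs.1 x hx, hs.2 ▸ Multiset.le_sum_of_mem (Multiset.mem_map_of_mem w hx)⟩

theorem card_le_weight (hs : s ∈ multisetsOfWeight w n) : s.card ≤ n := by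
  have h := Multiset.card_nsmul_le_sum (s := s.map w) (a := 1) fun y hy ↦ by
    obtain ⟨x, hx, rfl⟩ := Multiset.mem_map.1 hy
    exact hs.1 x hx
  simpa [hs.2] using h

theorem multisetsOfWeight_zero : multisetsOfWeight w 0 = {0} := by
  refine Set.eq_singleton_iff_unique_mem.2 ⟨by simp [multisetsOfWeight], fun s hs ↦ ?_⟩
  exact Multiset.card_eq_zero.1 (Nat.le_zero.1 (card_le_weight hs))

theorem finite_setOf_weight_mem_Icc (hw : ∀ l ≠ 0, (w ⁻¹' {l}).Finite) (n : ℕ) :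
    {x | w x ∈ Set.Icc 1 n}.Finite :=
  (Set.finite_Icc 1 n).preimage' fun l hl ↦ hw l (Nat.one_le_iff_ne_zero.1 hl.1)

theorem finite_multisetsOfWeight (hw : ∀ l ≠ 0, (w ⁻¹' {l}).Finite) (n : ℕ) :
    (multisetsOfWeight w n).Finite := by
  classical
  refine (Set.finite_Iic (n • (finite_setOf_weight_mem_Icc hw n).toFinset.val)).subset
    fun s hs ↦ Multiset.le_iff_count.2 fun x ↦ ?_
  by_cases hx : x ∈ s
  · have hmem : x ∈ (finite_setOf_weight_mem_Icc hw n).toFinset :=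
      (Set.Finite.mem_toFinset _).2 (weight_mem_Icc hs hx)
    rw [Multiset.count_nsmul, Multiset.count_eq_one_of_mem (Finset.nodup _) hmem, mul_one]
    exact (Multiset.count_le_card x s).trans (card_le_weight hs)
  · simp [Multiset.count_eq_zero_of_notMem hx]

theorem add_replicate_mem_multisetsOfWeight_iff {x : α} (hx : 0 < w x) {j : ℕ} :
    s + Multiset.replicate j x ∈ multisetsOfWeight w (n + j * w x) ↔
      s ∈ multisetsOfWeight w n := by
  simp only [multisetsOfWeight, Set.mem_ofPred_eq, Multiset.mem_add, Multiset.mem_replicate,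
    Multiset.map_add, Multiset.map_replicate, Multiset.sum_add, Multiset.sum_replicate,
    smul_eq_mul, Nat.add_right_cancel_iff]
  grind

theorem ncard_replicate_le {x : α} (hx : 0 < w x) {j : ℕ} (hj : j * w x ≤ n) :
    {s ∈ multisetsOfWeight w n | Multiset.replicate j x ≤ s}.ncard =
      (multisetsOfWeight w (n - j * w x)).ncard := by
  obtain ⟨m, rfl⟩ := Nat.exists_eq_add_of_le' hj
  rw [Nat.add_sub_cancel, ← Set.ncard_image_of_injective (multisetsOfWeight w m)
    (add_left_injective (Multiset.replicate j x))]
  congr 1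
  ext s
  constructor
  · rintro ⟨hs, hle⟩
    obtain ⟨t, rfl⟩ := Multiset.le_iff_exists_add.1 hle
    rw [add_comm (Multiset.replicate j x) t] at hs ⊢
    exact ⟨t, (add_replicate_mem_multisetsOfWeight_iff hx).1 hs, rfl⟩
  · rintro ⟨t, ht, rfl⟩
    exact ⟨(add_replicate_mem_multisetsOfWeight_iff hx).2 ht, Multiset.le_add_left _ _⟩

theorem mul_weight_le_of_replicate_le (hs : s ∈ multisetsOfWeight w n) {x : α} {j : ℕ}
    (hj : Multiset.replicate j x ≤ s) : j * w x ≤ n := by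
  obtain ⟨t, rfl⟩ := Multiset.le_iff_exists_add.1 hj
  simp only [← hs.2, Multiset.map_add, Multiset.map_replicate, Multiset.sum_add,
    Multiset.sum_replicate, smul_eq_mul, Nat.le_add_right]

open Classical in
theorem sum_weight_replicate_le_eq (hs : s ∈ multisetsOfWeight w n) {X : Finset α}
    (hX : ∀ x ∈ s, x ∈ X) :
    ∑ y ∈ X ×ˢ Finset.Icc 1 n with Multiset.replicate y.2 y.1 ≤ s, w y.1 = n := by
  have hcount (x : α) : {j ∈ Finset.Icc 1 n | Multiset.replicate j x ≤ s} =
      Finset.Icc 1 (s.count x) := by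
    have hle := (Multiset.count_le_card x s).trans (card_le_weight hs)
    ext j
    simp only [Finset.mem_filter, Finset.mem_Icc, ← Multiset.le_count_iff_replicate_le]
    lia
  calc ∑ y ∈ X ×ˢ Finset.Icc 1 n with Multiset.replicate y.2 y.1 ≤ s, w y.1
      = ∑ x ∈ X, s.count x * w x := by
        simp only [Finset.sum_filter, Finset.sum_product]
        refine Finset.sum_congr rfl fun x _ ↦ ?_
        rw [← Finset.sum_filter, hcount, Finset.sum_const, Nat.card_Icc, Nat.add_sub_cancel,
          smul_eq_mul]
    _ = ∑ x ∈ s.toFinset, s.count x * w x :=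
        (Finset.sum_subset (fun x hx ↦ hX x (Multiset.mem_toFinset.1 hx)) fun x _ hx ↦ by
          rw [Multiset.count_eq_zero_of_notMem (mt Multiset.mem_toFinset.2 hx), zero_mul]).symm
    _ = n := by simpa only [hs.2, smul_eq_mul] using (Finset.sum_multiset_map_count s w).symm

theorem mul_levelCount_eq_sum {X : Finset α} {l : ℕ} (hX : ∀ x, w x = l → x ∈ X) :
    l * levelCount w l = ∑ x ∈ X with w x = l, w x := by
  have hcoe : w ⁻¹' {l} = ({x ∈ X | w x = l} : Finset α) := by
    ext x
    simpa using hX x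
  rw [levelCount, hcoe, Set.ncard_coe_finset,
    Finset.sum_congr rfl fun x hx ↦ (Finset.mem_filter.1 hx).2, Finset.sum_const, smul_eq_mul,
    mul_comm]

theorem divisorWeight_eq_sum_dvd {X : Finset α} {k : ℕ} (hk : k ∈ Finset.Icc 1 n)
    (hX : ∀ x, x ∈ X ↔ w x ∈ Set.Icc 1 n) :
    divisorWeight w k = ∑ x ∈ X with w x ∣ k, w x := by
  obtain ⟨hk1, hkn⟩ := Finset.mem_Icc.1 hk
  have hlevel : ∀ l ∈ k.divisors, l * levelCount w l = ∑ x ∈ X with w x = l, w x := by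
    refine fun l hl ↦ mul_levelCount_eq_sum fun x hx ↦ (hX x).2 ?_
    rw [hx]
    exact ⟨Nat.pos_of_mem_divisors hl, (Nat.divisor_le hl).trans hkn⟩
  rw [divisorWeight, Finset.sum_congr rfl hlevel, ← Finset.sum_fiberwise_of_maps_to
    (fun x hx ↦ Nat.mem_divisors.2 ⟨(Finset.mem_filter.1 hx).2, by lia⟩) w]
  refine Finset.sum_congr rfl fun l hl ↦ Finset.sum_congr ?_ fun _ _ ↦ rfl
  have := Nat.dvd_of_mem_divisors hl
  grind

theorem divisorWeight_eq_sum {X : Finset α} {k : ℕ} (hk : k ∈ Finset.Icc 1 n)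
    (hX : ∀ x, x ∈ X ↔ w x ∈ Set.Icc 1 n) :
    divisorWeight w k = ∑ y ∈ X ×ˢ Finset.Icc 1 n with y.2 * w y.1 = k, w y.1 := by
  obtain ⟨hk1, hkn⟩ := Finset.mem_Icc.1 hk
  rw [divisorWeight_eq_sum_dvd hk hX]
  refine Finset.sum_bij' (fun x _ ↦ (x, k / w x)) (fun y _ ↦ y.1) ?_ ?_ (fun _ _ ↦ rfl) ?_
    fun _ _ ↦ rfl
  · intro x hx
    obtain ⟨hxX, hxk⟩ := Finset.mem_filter.1 hx
    have hpos := Nat.div_pos (Nat.le_of_dvd hk1 hxk) ((hX x).1 hxX).1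
    simp only [Finset.mem_filter, Finset.mem_product, Finset.mem_Icc]
    exact ⟨⟨hxX, hpos, (Nat.div_le_self _ _).trans hkn⟩, Nat.div_mul_cancel hxk⟩
  · intro y hy
    simp only [Finset.mem_filter, Finset.mem_product] at hy ⊢
    exact ⟨hy.1.1, Dvd.intro_left _ hy.2⟩
  · intro y hy
    simp only [Finset.mem_filter, Finset.mem_product] at hy
    rw [← hy.2, Nat.mul_div_cancel _ ((hX _).1 hy.1.1).1]

/-- Both sides count the triples of a multiset, a letter `x` and a `j` such that the multiset
contains at least `j` copies of `x`, weighted by `w x`. -/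
theorem mul_ncard_multisetsOfWeight (hw : ∀ l ≠ 0, (w ⁻¹' {l}).Finite) (n : ℕ) :
    n * (multisetsOfWeight w n).ncard =
      ∑ k ∈ Finset.Icc 1 n, divisorWeight w k * (multisetsOfWeight w (n - k)).ncard := by
  classical
  set M := (finite_multisetsOfWeight hw n).toFinset
  set X := (finite_setOf_weight_mem_Icc hw n).toFinset
  have hmem (s : Multiset α) : s ∈ M ↔ s ∈ multisetsOfWeight w n := Set.Finite.mem_toFinset _
  have hXmem (x : α) : x ∈ X ↔ w x ∈ Set.Icc 1 n := Set.Finite.mem_toFinset _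
  set T := {y ∈ X ×ˢ Finset.Icc 1 n | y.2 * w y.1 ≤ n} with hT
  calc n * (multisetsOfWeight w n).ncard = ∑ _ ∈ M, n := by
        rw [Finset.sum_const, smul_eq_mul, mul_comm,
          Set.ncard_eq_toFinset_card _ (finite_multisetsOfWeight hw n)]
    _ = ∑ s ∈ M, ∑ y ∈ T with Multiset.replicate y.2 y.1 ≤ s, w y.1 := by
        refine Finset.sum_congr rfl fun s hs ↦ ?_
        rw [hmem] at hs
        rw [← sum_weight_replicate_le_eq hs fun x hx ↦ (hXmem x).2 (weight_mem_Icc hs hx),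
          hT, Finset.filter_filter]
        refine Finset.sum_congr (Finset.filter_congr fun y _ ↦ ?_) fun _ _ ↦ rfl
        exact ⟨fun h ↦ ⟨mul_weight_le_of_replicate_le hs h, h⟩, fun h ↦ h.2⟩
    _ = ∑ y ∈ T, w y.1 * (multisetsOfWeight w (n - y.2 * w y.1)).ncard := by
        simp only [Finset.sum_filter (s := T)]
        rw [Finset.sum_comm]
        refine Finset.sum_congr rfl fun y hy ↦ ?_
        simp only [hT, Finset.mem_filter, Finset.mem_product, hXmem] at hy
        rw [← Finset.sum_filter, Finset.sum_const, smul_eq_mul, mul_comm,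
          ← ncard_replicate_le hy.1.1.1 hy.2, ← Set.ncard_coe_finset, Finset.coe_filter]
        simp only [hmem]
    _ = ∑ k ∈ Finset.Icc 1 n, divisorWeight w k * (multisetsOfWeight w (n - k)).ncard := by
        rw [← Finset.sum_fiberwise_of_maps_to (t := Finset.Icc 1 n) (g := fun y ↦ y.2 * w y.1)]
        · refine Finset.sum_congr rfl fun k hk ↦ ?_
          rw [divisorWeight_eq_sum hk hXmem, Finset.sum_mul, hT, Finset.filter_filter]
          refine Finset.sum_congr (Finset.filter_congr fun y _ ↦ ?_) fun y hy ↦ ?_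
          · grind
          · rw [(Finset.mem_filter.1 hy).2]
        · intro y hy
          simp only [hT, Finset.mem_filter, Finset.mem_product, hXmem, Finset.mem_Icc] at hy
          exact Finset.mem_Icc.2 ⟨Nat.mul_pos hy.1.2.1 hy.1.1.1, hy.2⟩

theorem one_le_levelCount (hw : ∀ l ≠ 0, (w ⁻¹' {l}).Finite) (hne : ∀ l ≠ 0, ∃ x, w x = l) {l : ℕ}
    (hl : l ≠ 0) : 1 ≤ levelCount w l :=
  (Set.ncard_pos (hw l hl)).2 (hne l hl)

theorem le_divisorWeight (hw : ∀ l ≠ 0, (w ⁻¹' {l}).Finite) (hne : ∀ l ≠ 0, ∃ x, w x = l) (k : ℕ) :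
    k ≤ divisorWeight w k := by
  rcases eq_or_ne k 0 with rfl | hk
  · exact Nat.zero_le _
  · calc k ≤ k * levelCount w k := Nat.le_mul_of_pos_right _ (one_le_levelCount hw hne hk)
      _ ≤ divisorWeight w k :=
        Finset.single_le_sum (f := fun l ↦ l * levelCount w l) (fun _ _ ↦ Nat.zero_le _)
          (Nat.mem_divisors_self k hk)

theorem summable_divisorWeight_mul_rpow {σ : ℝ} (hσ : 0 < σ)
    (hsum : Summable fun l ↦ (levelCount w l : ℝ) * (l : ℝ) ^ (-σ)) :
    Summable fun k ↦ (divisorWeight w k : ℝ) * (k : ℝ) ^ (-(σ + 1)) := by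
  have h := summable_sum_divisors_mul_rpow (f := fun l ↦ l * levelCount w l) (s := σ + 1)
    (by linarith) (hsum.congr fun l ↦ ?_)
  · simpa [divisorWeight] using h
  · rcases Nat.eq_zero_or_pos l with rfl | hl
    · simp [Real.zero_rpow (by linarith : -σ ≠ 0)]
    · rw [neg_add, Real.rpow_add (by positivity), Real.rpow_neg_one]
      field_simp

end WeightedMultisets

/-! ### Coefficients of the exponential of a power series -/

section ExponentialOfPowerSeries

open scoped Nat

variable {c : ℕ → ℂ}

theorem hasFPowerSeriesOnBall_tsum
    (hc : ∀ ρ : ℝ, 0 < ρ → ρ < 1 → Summable fun k ↦ ‖c k‖ * ρ ^ k) :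
    HasFPowerSeriesOnBall (fun z ↦ ∑' k, c k * z ^ k) (.ofScalars ℂ c) 0 1 := by
  have hradius : 1 ≤ (FormalMultilinearSeries.ofScalars ℂ c).radius := by
    refine ENNReal.le_of_forall_nnreal_lt fun ρ hρ ↦ ?_
    rcases eq_zero_or_pos ρ with rfl | hρ0
    · exact bot_le
    · refine FormalMultilinearSeries.le_radius_of_summable _ ?_
      simpa only [FormalMultilinearSeries.ofScalars_norm] using hc ρ hρ0 (by exact_mod_cast hρ)
  have h := ((FormalMultilinearSeries.ofScalars ℂ c).hasFPowerSeriesOnBall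
    (one_pos.trans_le hradius)).mono one_pos hradius
  refine h.congr fun z _ ↦ ?_
  simp only [FormalMultilinearSeries.sum, FormalMultilinearSeries.ofScalars_apply_eq, smul_eq_mul]

theorem iteratedDeriv_eq_of_hasFPowerSeriesOnBall {f : ℂ → ℂ} {x : ℂ} {r : ENNReal}
    (hf : HasFPowerSeriesOnBall f (.ofScalars ℂ c) x r) (n : ℕ) :
    iteratedDeriv n f x = n ! * c n := by
  rw [iteratedDeriv_eq_iteratedFDeriv, ← hf.factorial_smul 1 n,
    FormalMultilinearSeries.ofScalars_apply_eq, one_pow, smul_eq_mul, mul_one, nsmul_eq_mul]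

theorem iteratedDeriv_succ_cexp {f : ℂ → ℂ} {x : ℂ} (hf : AnalyticAt ℂ f x) (n : ℕ) :
    iteratedDeriv (n + 1) (fun z ↦ Complex.exp (f z)) x =
      ∑ i ∈ Finset.range (n + 1), n.choose i * iteratedDeriv (i + 1) f x *
        iteratedDeriv (n - i) (fun z ↦ Complex.exp (f z)) x := by
  have hderiv : deriv (fun z ↦ Complex.exp (f z)) =ᶠ[𝓝 x]
      fun z ↦ deriv f z * Complex.exp (f z) := by
    filter_upwards [hf.eventually_analyticAt] with z hz
    rw [deriv_cexp hz.differentiableAt, mul_comm]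
  rw [iteratedDeriv_succ', hderiv.iteratedDeriv_eq,
    iteratedDeriv_fun_mul hf.deriv.contDiffAt hf.cexp'.contDiffAt]
  simp only [iteratedDeriv_succ']

variable {b : ℕ → ℂ}

theorem iteratedDeriv_cexp_eq {f : ℂ → ℂ} {r : ENNReal} {x : ℂ}
    (hf : HasFPowerSeriesOnBall f (.ofScalars ℂ c) x r) (hb0 : b 0 = Complex.exp (c 0))
    (hb : ∀ n : ℕ, (n + 1) * b (n + 1) =
      ∑ i ∈ Finset.range (n + 1), (i + 1) * c (i + 1) * b (n - i)) (n : ℕ) :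
    iteratedDeriv n (fun z ↦ Complex.exp (f z)) x = n ! * b n := by
  induction n using Nat.strong_induction_on with
  | _ n ih =>
    rcases n with _ | n
    · have h0 := iteratedDeriv_eq_of_hasFPowerSeriesOnBall hf 0
      simp only [iteratedDeriv_zero, Nat.factorial_zero, Nat.cast_one, one_mul] at h0 ⊢
      rw [h0, hb0]
    · rw [iteratedDeriv_succ_cexp hf.analyticAt, Nat.factorial_succ, Nat.cast_mul, mul_right_comm,
        Nat.cast_succ, hb, Finset.sum_mul]
      refine Finset.sum_congr rfl fun i hi ↦ ?_
      have hin : i ≤ n := Finset.mem_range_succ_iff.1 hi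
      rw [iteratedDeriv_eq_of_hasFPowerSeriesOnBall hf, ih (n - i) (by lia), Nat.factorial_succ,
        ← Nat.choose_mul_factorial_mul_factorial hin]
      push_cast
      ring

theorem integral_circleMap_eq {f : ℂ → ℂ} {r : ℝ} (hr : 0 < r)
    (hf : DifferentiableOn ℂ f (Metric.closedBall 0 r)) (n : ℕ) :
    ∫ θ in -π..π, f (circleMap 0 r θ) * Complex.exp (-(n * θ * I)) =
      2 * π * r ^ n * (iteratedDeriv n f 0 / n !) := by
  have hr0 : (r : ℂ) ≠ 0 := by exact_mod_cast hr.ne'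
  have hcauchy := hf.circleIntegral_one_div_sub_center_pow_smul hr n
  have hperiodic : Function.Periodic
      (fun θ : ℝ ↦ f (circleMap 0 r θ) * (circleMap 0 r θ ^ n)⁻¹) (2 * π) := fun θ ↦ by
    simp only [periodic_circleMap 0 r θ]
  have hshift := hperiodic.intervalIntegral_add_eq (-π) 0
  rw [show -π + 2 * π = π by ring, zero_add] at hshift
  have hintegrand (θ : ℝ) : f (circleMap 0 r θ) * Complex.exp (-(n * θ * I)) =
      r ^ n * (f (circleMap 0 r θ) * (circleMap 0 r θ ^ n)⁻¹) := by
    rw [circleMap_zero, mul_pow, ← Complex.exp_nat_mul, mul_inv, ← Complex.exp_neg, ← mul_assoc]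
    field_simp
  have hcircle : ∮ z in C(0, r), (1 / (z - 0) ^ (n + 1)) • f z =
      I * ∫ θ in 0..2 * π, f (circleMap 0 r θ) * (circleMap 0 r θ ^ n)⁻¹ := by
    rw [circleIntegral, ← intervalIntegral.integral_const_mul]
    refine intervalIntegral.integral_congr fun θ _ ↦ ?_
    have hne : circleMap 0 r θ ≠ 0 := circleMap_ne_center hr.ne'
    simp only [deriv_circleMap, sub_zero, smul_eq_mul]
    field_simp
    ring
  rw [hcircle, smul_eq_mul] at hcauchy
  simp only [hintegrand, intervalIntegral.integral_const_mul]
  rw [hshift, mul_left_cancel₀ Complex.I_ne_zero (hcauchy.trans (by ring :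
    _ = I * (2 * π * (iteratedDeriv n f 0 / n !))))]
  ring

theorem integral_cexp_tsum_eq (hc : ∀ ρ : ℝ, 0 < ρ → ρ < 1 → Summable fun k ↦ ‖c k‖ * ρ ^ k)
    (hb0 : b 0 = Complex.exp (c 0))
    (hb : ∀ n : ℕ, (n + 1) * b (n + 1) =
      ∑ i ∈ Finset.range (n + 1), (i + 1) * c (i + 1) * b (n - i))
    {r : ℝ} (hr : 0 < r) (hr1 : r < 1) (n : ℕ) :
    ∫ θ in -π..π, Complex.exp (∑' k, c k * circleMap 0 r θ ^ k) * Complex.exp (-(n * θ * I)) =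
      2 * π * r ^ n * b n := by
  have hseries := hasFPowerSeriesOnBall_tsum hc
  have hdiff : DifferentiableOn ℂ (fun z ↦ Complex.exp (∑' k, c k * z ^ k))
      (Metric.closedBall 0 r) := by
    refine (hseries.differentiableOn.mono fun z hz ↦ ?_).cexp
    rw [← ENNReal.ofReal_one, Metric.eball_ofReal]
    exact Metric.closedBall_subset_ball hr1 hz
  rw [integral_circleMap_eq hr hdiff, iteratedDeriv_cexp_eq hseries hb0 hb,
    mul_div_cancel_left₀ _ (by exact_mod_cast n.factorial_ne_zero)]

end ExponentialOfPowerSeries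

/-! ### The moments `S_m` -/

/-- The `k`-th term `a k * k ^ m * e ^ (-k / ω)` of the series `moment a m ω`. -/
noncomputable def momentTerm (a : ℕ → ℝ) (m : ℤ) (ω : ℝ) (k : ℕ) : ℝ :=
  a k * (k : ℝ) ^ m * Real.exp (-(k : ℝ) / ω)

/-- The series `∑ k, a k * k ^ m * e ^ (-k / ω)`, which is `S_m(ω)` when `a k = ∑_{ℓ ∣ k} ℓ d(ℓ)`.
It is the moment of order `m + 1` of the measure with mass `momentTerm a (-1) ω k` at `k`. -/
noncomputable def moment (a : ℕ → ℝ) (m : ℤ) (ω : ℝ) : ℝ := ∑' k : ℕ, momentTerm a m ω k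

/-- Coefficient sequences that grow at least linearly and whose Dirichlet series converges at `s`.
The first condition gives the cubic growth of `moment a 1`, the second one bounds `moment a m ω` by
a multiple of `ω ^ (m + s)`. -/
structure IsAdmissible (a : ℕ → ℝ) (s : ℝ) : Prop where
  map_zero : a 0 = 0
  natCast_le (k : ℕ) : (k : ℝ) ≤ a k
  summable : Summable fun k : ℕ ↦ a k * (k : ℝ) ^ (-s)

theorem exp_neg_natCast_div (ω : ℝ) (k : ℕ) :
    Real.exp (-(k : ℝ) / ω) = Real.exp (-1 / ω) ^ k := by
  rw [← Real.exp_nat_mul]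
  congr 1
  ring

theorem exp_neg_one_div_lt_one {ω : ℝ} (hω : 0 < ω) : Real.exp (-1 / ω) < 1 :=
  Real.exp_lt_one_iff.2 (div_neg_of_neg_of_pos (by norm_num) hω)

theorem one_sub_exp_neg_one_div_le (ω : ℝ) : 1 - Real.exp (-1 / ω) ≤ 1 / ω := by
  have h := Real.add_one_le_exp (-1 / ω)
  rw [neg_div] at h ⊢
  linarith

theorem half_le_exp_neg_one_div {ω : ℝ} (hω : 2 ≤ ω) : 1 / 2 ≤ Real.exp (-1 / ω) := by
  have h : 1 / ω ≤ 1 / 2 := one_div_le_one_div_of_le two_pos hω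
  linarith [one_sub_exp_neg_one_div_le ω]

theorem rpow_le_mul_exp {x y : ℝ} (hx : 0 < x) (hy : 0 ≤ y) : y ^ x ≤ x ^ x * Real.exp y := by
  have h : y ≤ x * Real.exp (y / x) := by
    rw [← div_le_iff₀' hx]
    linarith [Real.add_one_le_exp (y / x)]
  calc y ^ x ≤ (x * Real.exp (y / x)) ^ x := Real.rpow_le_rpow hy h hx.le
    _ = x ^ x * Real.exp y := by
      rw [Real.mul_rpow hx.le (Real.exp_pos _).le, ← Real.exp_mul, div_mul_cancel₀ _ hx.ne']

theorem zpow_mul_exp_le {m : ℤ} {s : ℝ} (hm : 0 < m + s) {x ω : ℝ} (hx : 0 < x) (hω : 0 < ω) :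
    x ^ m * Real.exp (-x / ω) ≤ (m + s) ^ (m + s) * ω ^ (m + s) * x ^ (-s) := by
  have h := rpow_le_mul_exp hm (div_nonneg hx.le hω.le)
  rw [Real.div_rpow hx.le hω.le, div_le_iff₀ (by positivity), Real.rpow_add hx,
    Real.rpow_intCast] at h
  rw [neg_div, Real.exp_neg, Real.rpow_neg hx.le, ← div_eq_mul_inv, ← div_eq_mul_inv,
    div_le_div_iff₀ (Real.exp_pos _) (by positivity)]
  linarith

theorem natCast_mul_momentTerm {a : ℕ → ℝ} (ha : a 0 = 0) (m : ℤ) (ω : ℝ) (k : ℕ) :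
    k * momentTerm a m ω k = momentTerm a (m + 1) ω k := by
  rcases Nat.eq_zero_or_pos k with rfl | hk
  · simp [momentTerm, ha]
  · rw [momentTerm, momentTerm, zpow_add_one₀ (by positivity)]
    ring

namespace IsAdmissible

variable {a : ℕ → ℝ} {s : ℝ} {m : ℤ} {ω : ℝ}

theorem nonneg (ha : IsAdmissible a s) (k : ℕ) : 0 ≤ a k :=
  k.cast_nonneg.trans (ha.natCast_le k)

theorem pos (ha : IsAdmissible a s) {k : ℕ} (hk : 0 < k) : 0 < a k :=
  (Nat.cast_pos.2 hk).trans_le (ha.natCast_le k)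

theorem two_lt (ha : IsAdmissible a s) : 2 < s := by
  suffices 1 < s - 1 by linarith
  refine one_lt_of_summable_mul_rpow (f := fun k ↦ a k / k) (fun k hk ↦ ?_)
    (ha.summable.congr fun k ↦ ?_)
  · exact (one_le_div (by positivity)).2 (ha.natCast_le k)
  · rcases Nat.eq_zero_or_pos k with rfl | hk
    · simp [ha.map_zero]
    · rw [neg_sub, sub_eq_add_neg, Real.rpow_add (by positivity), Real.rpow_one]
      field_simp

theorem intCast_add_pos (ha : IsAdmissible a s) (hm : -1 ≤ m) : 0 < m + s := by
  have : (-1 : ℝ) ≤ m := by exact_mod_cast hm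
  linarith [ha.two_lt]

theorem momentTerm_zero (ha : IsAdmissible a s) : momentTerm a m ω 0 = 0 := by
  simp [momentTerm, ha.map_zero]

theorem momentTerm_nonneg (ha : IsAdmissible a s) (k : ℕ) : 0 ≤ momentTerm a m ω k := by
  have := ha.nonneg k
  rw [momentTerm]
  positivity

theorem momentTerm_le (ha : IsAdmissible a s) (hm : -1 ≤ m) (hω : 0 < ω) (k : ℕ) :
    momentTerm a m ω k ≤ (m + s) ^ (m + s) * ω ^ (m + s) * (a k * (k : ℝ) ^ (-s)) := by
  rcases Nat.eq_zero_or_pos k with rfl | hk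
  · simp [momentTerm, ha.map_zero]
  · calc momentTerm a m ω k
        = a k * ((k : ℝ) ^ m * Real.exp (-(k : ℝ) / ω)) := by rw [momentTerm, mul_assoc]
      _ ≤ a k * ((m + s) ^ (m + s) * ω ^ (m + s) * (k : ℝ) ^ (-s)) :=
        mul_le_mul_of_nonneg_left (zpow_mul_exp_le (ha.intCast_add_pos hm) (Nat.cast_pos.2 hk) hω)
          (ha.nonneg k)
      _ = (m + s) ^ (m + s) * ω ^ (m + s) * (a k * (k : ℝ) ^ (-s)) := by ring

theorem summable_momentTerm (ha : IsAdmissible a s) (hm : -1 ≤ m) (hω : 0 < ω) :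
    Summable (momentTerm a m ω) :=
  .of_nonneg_of_le ha.momentTerm_nonneg (ha.momentTerm_le hm hω) (ha.summable.mul_left _)

theorem exists_moment_le (ha : IsAdmissible a s) (hm : -1 ≤ m) :
    ∃ C > 0, ∀ ω > 0, moment a m ω ≤ C * ω ^ (m + s) := by
  have hms := ha.intCast_add_pos hm
  have hpos : 0 < ∑' k : ℕ, a k * (k : ℝ) ^ (-s) :=
    ha.summable.tsum_pos (fun k ↦ mul_nonneg (ha.nonneg k) (by positivity)) 1
      (by simpa using ha.pos one_pos)
  refine ⟨(m + s) ^ (m + s) * ∑' k : ℕ, a k * (k : ℝ) ^ (-s), by positivity, fun ω hω ↦ ?_⟩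
  rw [mul_right_comm, ← tsum_mul_left]
  exact (ha.summable_momentTerm hm hω).tsum_le_tsum (ha.momentTerm_le hm hω)
    (ha.summable.mul_left _)

theorem moment_pos (ha : IsAdmissible a s) (hm : -1 ≤ m) (hω : 0 < ω) : 0 < moment a m ω :=
  (ha.summable_momentTerm hm hω).tsum_pos ha.momentTerm_nonneg 1 <| by
    have := ha.pos one_pos
    rw [momentTerm]
    positivity

theorem moment_le_moment_add_one (ha : IsAdmissible a s) (hm : -1 ≤ m) (hω : 0 < ω) :
    moment a m ω ≤ moment a (m + 1) ω := by
  refine (ha.summable_momentTerm hm hω).tsum_le_tsum (fun k ↦ ?_)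
    (ha.summable_momentTerm (by lia) hω)
  rcases Nat.eq_zero_or_pos k with rfl | hk
  · rw [ha.momentTerm_zero, ha.momentTerm_zero]
  · rw [← natCast_mul_momentTerm ha.map_zero]
    exact le_mul_of_one_le_left (ha.momentTerm_nonneg k) (by exact_mod_cast hk)

theorem choose_two_mul_pow_le_momentTerm (ha : IsAdmissible a s) (n : ℕ) :
    Real.exp (-1 / ω) * ((n + 2).choose 2 * Real.exp (-1 / ω) ^ n) ≤
      momentTerm a 1 ω (n + 1) := by
  have hchoose : (n + 2).choose 2 ≤ (n + 1) * (n + 1) := by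
    rw [Nat.choose_two_right, Nat.add_succ_sub_one]
    exact Nat.div_le_of_le_mul (by nlinarith)
  calc Real.exp (-1 / ω) * ((n + 2).choose 2 * Real.exp (-1 / ω) ^ n)
      = (n + 2).choose 2 * Real.exp (-1 / ω) ^ (n + 1) := by ring
    _ ≤ ((n + 1 : ℕ) * (n + 1 : ℕ)) * Real.exp (-1 / ω) ^ (n + 1) := by
        gcongr
        exact_mod_cast hchoose
    _ ≤ a (n + 1) * (n + 1 : ℕ) * Real.exp (-1 / ω) ^ (n + 1) := by
        gcongr
        exact ha.natCast_le _
    _ = momentTerm a 1 ω (n + 1) := by rw [momentTerm, zpow_one, exp_neg_natCast_div]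

theorem exp_div_cube_le_moment_one (ha : IsAdmissible a s) (hω : 0 < ω) :
    Real.exp (-1 / ω) * (1 / (1 - Real.exp (-1 / ω)) ^ 3) ≤ moment a 1 ω := by
  have hnorm : ‖Real.exp (-1 / ω)‖ < 1 := by
    rw [Real.norm_of_nonneg (Real.exp_pos _).le]
    exact exp_neg_one_div_lt_one hω
  have hsum := ha.summable_momentTerm (m := 1) (by norm_num) hω
  rw [moment, hsum.tsum_eq_zero_add, ha.momentTerm_zero, zero_add,
    ← tsum_choose_mul_geometric_of_norm_lt_one 2 hnorm, ← tsum_mul_left]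
  exact ((summable_choose_mul_geometric_of_norm_lt_one 2 hnorm).mul_left _).tsum_le_tsum
    ha.choose_two_mul_pow_le_momentTerm ((summable_nat_add_iff 1).2 hsum)

theorem cube_div_two_le_moment_one (ha : IsAdmissible a s) (hω : 2 ≤ ω) :
    ω ^ 3 / 2 ≤ moment a 1 ω := by
  have hω0 : 0 < ω := by linarith
  have hpos : 0 < 1 - Real.exp (-1 / ω) := sub_pos.2 (exp_neg_one_div_lt_one hω0)
  have hcube : ω ^ 3 ≤ 1 / (1 - Real.exp (-1 / ω)) ^ 3 := by
    rw [le_div_iff₀ (by positivity), ← mul_pow]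
    exact pow_le_one₀ (by positivity) ((le_div_iff₀' hω0).1 (one_sub_exp_neg_one_div_le ω))
  calc ω ^ 3 / 2 = 1 / 2 * ω ^ 3 := by ring
    _ ≤ Real.exp (-1 / ω) * (1 / (1 - Real.exp (-1 / ω)) ^ 3) := by
      gcongr
      exact half_le_exp_neg_one_div hω
    _ ≤ moment a 1 ω := ha.exp_div_cube_le_moment_one hω0

theorem momentTerm_lt_momentTerm (ha : IsAdmissible a s) {x y : ℝ} (hx : 0 < x) (hxy : x < y)
    {k : ℕ} (hk : 0 < k) : momentTerm a m x k < momentTerm a m y k := by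
  have hak := ha.pos hk
  have hexp : -(k : ℝ) / x < -(k : ℝ) / y := by
    rw [neg_div, neg_div, neg_lt_neg_iff]
    exact div_lt_div_of_pos_left (Nat.cast_pos.2 hk) hx hxy
  rw [momentTerm, momentTerm]
  gcongr

theorem momentTerm_le_momentTerm (ha : IsAdmissible a s) {x y : ℝ} (hx : 0 < x) (hxy : x < y)
    (k : ℕ) : momentTerm a m x k ≤ momentTerm a m y k := by
  rcases Nat.eq_zero_or_pos k with rfl | hk
  · rw [ha.momentTerm_zero, ha.momentTerm_zero]
  · exact (ha.momentTerm_lt_momentTerm hx hxy hk).le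

theorem continuousOn_moment (ha : IsAdmissible a s) (hm : -1 ≤ m) :
    ContinuousOn (moment a m) (Set.Ioi 0) := by
  intro x (hx : 0 < x)
  suffices ContinuousOn (moment a m) (Set.Ioo 0 (x + 1)) from
    (this.continuousAt (Ioo_mem_nhds hx (lt_add_one x))).continuousWithinAt
  refine continuousOn_tsum (fun k y hy ↦ ?_) (ha.summable_momentTerm hm (by linarith : 0 < x + 1))
    fun k y hy ↦ ?_
  · have := hy.1.ne'
    simp only [momentTerm]
    fun_prop (disch := assumption)
  · rw [Real.norm_of_nonneg (ha.momentTerm_nonneg k)]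
    exact ha.momentTerm_le_momentTerm hy.1 hy.2 k

theorem strictMonoOn_moment (ha : IsAdmissible a s) (hm : -1 ≤ m) :
    StrictMonoOn (moment a m) (Set.Ioi 0) := fun _ hx _ hy hxy ↦
  (ha.summable_momentTerm hm hx).tsum_lt_tsum (ha.momentTerm_le_momentTerm hx hxy)
    (ha.momentTerm_lt_momentTerm hx hxy one_pos) (ha.summable_momentTerm hm hy)

theorem tendsto_moment_nhdsGT_zero (ha : IsAdmissible a s) (hm : -1 ≤ m) :
    Tendsto (moment a m) (𝓝[>] 0) (𝓝 0) := by
  obtain ⟨C, -, hC⟩ := ha.exists_moment_le hm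
  have hms := ha.intCast_add_pos hm
  have hbound : Tendsto (fun ω : ℝ ↦ C * ω ^ (m + s)) (𝓝[>] 0) (𝓝 0) := by
    have h := (Real.continuousAt_rpow_const 0 (m + s) (.inr hms.le)).tendsto.const_mul C
    rw [Real.zero_rpow hms.ne', mul_zero] at h
    exact h.mono_left nhdsWithin_le_nhds
  refine squeeze_zero' ?_ ?_ hbound
  · filter_upwards [self_mem_nhdsWithin] with ω hω using (ha.moment_pos hm hω).le
  · filter_upwards [self_mem_nhdsWithin] with ω hω using hC ω hω

theorem natCast_le_moment_zero (ha : IsAdmissible a s) {n : ℕ} (hn : 1 ≤ n) :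
    n ≤ moment a 0 (3 * n : ℕ) := by
  have hpos : (0 : ℝ) < (3 * n : ℕ) := by positivity
  have hterm : (n : ℝ) ≤ momentTerm a 0 (3 * n : ℕ) (3 * n) := by
    rw [momentTerm, neg_div, div_self hpos.ne', zpow_zero, mul_one, Real.exp_neg,
      ← div_eq_mul_inv, le_div_iff₀ (Real.exp_pos _)]
    calc n * Real.exp 1 ≤ n * 3 := by gcongr; exact Real.exp_one_lt_three.le
      _ = (3 * n : ℕ) := by push_cast; ring
      _ ≤ a (3 * n) := ha.natCast_le _
  exact hterm.trans ((ha.summable_momentTerm (by norm_num) hpos).le_tsum _ fun k _ ↦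
    ha.momentTerm_nonneg k)

theorem existsUnique_moment_zero_eq (ha : IsAdmissible a s) {n : ℕ} (hn : 1 ≤ n) :
    ∃! ω : ℝ, 0 < ω ∧ moment a 0 ω = n := by
  have hn0 : (0 : ℝ) < n := by positivity
  obtain ⟨x, hxn, hx⟩ := ((((ha.tendsto_moment_nhdsGT_zero (m := 0) (by norm_num)).eventually
    (gt_mem_nhds hn0)).and self_mem_nhdsWithin)).exists
  have hy : (0 : ℝ) < (3 * n : ℕ) := by positivity
  obtain ⟨ω, hω, hωn⟩ := (convex_Ioi (0 : ℝ)).isPreconnected.intermediate_value hx hy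
    (ha.continuousOn_moment (by norm_num)) ⟨hxn.le, ha.natCast_le_moment_zero hn⟩
  exact ⟨ω, ⟨hω, hωn⟩, fun ω' h ↦
    (ha.strictMonoOn_moment (by norm_num)).injOn h.1 hω (h.2.trans hωn.symm)⟩

theorem tendsto_atTop_of_moment_zero_eq (ha : IsAdmissible a s) {ω : ℕ → ℝ}
    (h : ∀ n : ℕ, 1 ≤ n → 0 < ω n ∧ moment a 0 (ω n) = n) : Tendsto ω atTop atTop := by
  refine tendsto_atTop.2 fun b ↦ ?_
  filter_upwards [eventually_ge_atTop 1, eventually_ge_atTop ⌈moment a 0 (max b 1)⌉₊]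
    with n hn hn'
  refine (le_max_left b 1).trans ?_
  rw [← (ha.strictMonoOn_moment (m := 0) (by norm_num)).le_iff_le
    (show 0 < max b 1 by positivity) (h n hn).1, (h n hn).2]
  exact Nat.ceil_le.1 hn'

end IsAdmissible

/-! ### The logarithm of the characteristic function -/

/-- If `a k / k` are the coefficients of the logarithm of a generating function, then `logChar a ω`
is the logarithm of the characteristic function of the associated Boltzmann distribution with
parameter `e ^ (-1 / ω)`, centred at its mean `moment a 0 ω`. -/
noncomputable def logChar (a : ℕ → ℝ) (ω θ : ℝ) : ℂ :=
  ∑' k : ℕ, (momentTerm a (-1) ω k : ℂ) * (Complex.exp (k * θ * I) - 1 - k * θ * I)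

theorem norm_cexp_natCast_mul_I (k : ℕ) (θ : ℝ) : ‖Complex.exp (k * θ * I)‖ = 1 := by
  simpa using Complex.norm_exp_ofReal_mul_I (k * θ)

theorem norm_cexp_mul_I_sub_taylor_le (x : ℝ) :
    ‖Complex.exp (x * I) - 1 - x * I + x ^ 2 / 2‖ ≤ 4 * |x| ^ 3 := by
  have hI : ‖(x * I : ℂ)‖ = |x| := by simp
  rcases le_total |x| 1 with hx | hx
  · have htaylor := Complex.exp_bound (x := x * I) (by rwa [hI]) (n := 3) (by norm_num)
    have hsum : Complex.exp (x * I) - ∑ m ∈ Finset.range 3, (x * I) ^ m / m.factorial =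
        Complex.exp (x * I) - 1 - x * I + x ^ 2 / 2 := by
      simp only [Finset.sum_range_succ, Finset.sum_range_zero, mul_pow, Complex.I_sq]
      norm_num [Nat.factorial]
      ring
    rw [hsum, hI] at htaylor
    refine htaylor.trans ?_
    rw [mul_comm]
    gcongr
    norm_num [Nat.factorial]
  · calc ‖Complex.exp (x * I) - 1 - x * I + x ^ 2 / 2‖
        ≤ ‖Complex.exp (x * I)‖ + ‖(1 : ℂ)‖ + ‖(x * I : ℂ)‖ + ‖((x : ℂ) ^ 2 / 2)‖ :=
          norm_add_le_of_le (norm_sub_le_of_le (norm_sub_le _ _) le_rfl) le_rfl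
      _ = 2 + |x| + |x| ^ 2 / 2 := by
          rw [Complex.norm_exp_ofReal_mul_I, hI, norm_one, norm_div, norm_pow, Complex.norm_real,
            Real.norm_eq_abs, Complex.norm_two]
          ring
      _ ≤ 4 * |x| ^ 3 := by
          nlinarith [le_self_pow₀ hx three_ne_zero, pow_le_pow_right₀ hx (Nat.le_succ 2)]

theorem hasSum_pow_mul_one_sub_cos {q : ℝ} (hq0 : 0 < q) (hq1 : q < 1) (θ : ℝ) :
    HasSum (fun k : ℕ ↦ q ^ k * (1 - Real.cos (k * θ)))
      (q * (1 + q) * (1 - Real.cos θ) / ((1 - q) * ((1 - q) ^ 2 + 2 * q * (1 - Real.cos θ)))) := by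
  have hz : ‖(q * Complex.exp (θ * I) : ℂ)‖ < 1 := by
    rwa [norm_mul, Complex.norm_exp_ofReal_mul_I, mul_one, Complex.norm_real,
      Real.norm_of_nonneg hq0.le]
  have hq : 0 < 1 - q := sub_pos.2 hq1
  have hcos : 0 ≤ 1 - Real.cos θ := sub_nonneg.2 (Real.cos_le_one θ)
  have : 0 < (1 - q) ^ 2 + 2 * q * (1 - Real.cos θ) := by positivity
  have hre_pow (k : ℕ) : ((q * Complex.exp (θ * I) : ℂ) ^ k).re = q ^ k * Real.cos (k * θ) := by
    rw [mul_pow, ← Complex.exp_nat_mul, ← Complex.ofReal_pow, Complex.re_ofReal_mul,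
      ← mul_assoc, ← Complex.ofReal_natCast, ← Complex.ofReal_mul, Complex.exp_ofReal_mul_I_re]
  have hre_inv : ((1 - q * Complex.exp (θ * I) : ℂ)⁻¹).re =
      (1 - q * Real.cos θ) / ((1 - q) ^ 2 + 2 * q * (1 - Real.cos θ)) := by
    rw [Complex.inv_re, Complex.normSq_apply, Complex.sub_re, Complex.sub_im,
      Complex.re_ofReal_mul, Complex.im_ofReal_mul, Complex.exp_ofReal_mul_I_re,
      Complex.exp_ofReal_mul_I_im, Complex.one_re, Complex.one_im]
    congr 1
    linear_combination q ^ 2 * Real.sin_sq_add_cos_sq θ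
  have hgeom := Complex.hasSum_re (hasSum_geometric_of_norm_lt_one hz)
  simp only [hre_pow, hre_inv] at hgeom
  have hsum := (hasSum_geometric_of_lt_one hq0.le hq1).sub hgeom
  have hvalue : (1 - q)⁻¹ - (1 - q * Real.cos θ) / ((1 - q) ^ 2 + 2 * q * (1 - Real.cos θ)) =
      q * (1 + q) * (1 - Real.cos θ) /
        ((1 - q) * ((1 - q) ^ 2 + 2 * q * (1 - Real.cos θ))) := by
    field_simp
    ring
  rw [hvalue] at hsum
  simpa only [← mul_one_sub] using hsum

namespace IsAdmissible

variable {a : ℕ → ℝ} {s ω : ℝ}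

theorem norm_momentTerm_mul_cexp (ha : IsAdmissible a s) (m : ℤ) (θ : ℝ) (k : ℕ) :
    ‖(momentTerm a m ω k : ℂ) * Complex.exp (k * θ * I)‖ = momentTerm a m ω k := by
  rw [norm_mul, norm_cexp_natCast_mul_I, mul_one, Complex.norm_real,
    Real.norm_of_nonneg (ha.momentTerm_nonneg k)]

theorem hasSum_ofReal_moment (ha : IsAdmissible a s) {m : ℤ} (hm : -1 ≤ m) (hω : 0 < ω) :
    HasSum (fun k ↦ (momentTerm a m ω k : ℂ)) (moment a m ω) :=
  Complex.hasSum_ofReal.2 (ha.summable_momentTerm hm hω).hasSum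

theorem hasSum_logChar (ha : IsAdmissible a s) (hω : 0 < ω) (θ : ℝ) :
    HasSum (fun k : ℕ ↦ (momentTerm a (-1) ω k : ℂ) * (Complex.exp (k * θ * I) - 1 - k * θ * I))
      (∑' k : ℕ, (momentTerm a (-1) ω k : ℂ) * Complex.exp (k * θ * I) - moment a (-1) ω -
        moment a 0 ω * (θ * I)) := by
  have hexp : Summable fun k : ℕ ↦ (momentTerm a (-1) ω k : ℂ) * Complex.exp (k * θ * I) :=
    .of_norm_bounded (ha.summable_momentTerm le_rfl hω)
      fun k ↦ (ha.norm_momentTerm_mul_cexp (-1) θ k).le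
  have hterm (k : ℕ) :
      (momentTerm a (-1) ω k : ℂ) * (Complex.exp (k * θ * I) - 1 - k * θ * I) =
        momentTerm a (-1) ω k * Complex.exp (k * θ * I) - momentTerm a (-1) ω k -
          momentTerm a 0 ω k * (θ * I) := by
    rw [← neg_add_cancel (1 : ℤ), ← natCast_mul_momentTerm ha.map_zero]
    push_cast
    ring
  simp only [hterm]
  exact (hexp.hasSum.sub (ha.hasSum_ofReal_moment le_rfl hω)).sub
    ((ha.hasSum_ofReal_moment (m := 0) (by norm_num) hω).mul_right (θ * I))

theorem continuous_logChar (ha : IsAdmissible a s) (hω : 0 < ω) : Continuous (logChar a ω) := by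
  have hcont : Continuous fun θ : ℝ ↦
      ∑' k : ℕ, (momentTerm a (-1) ω k : ℂ) * Complex.exp (k * θ * I) :=
    continuous_tsum (fun k ↦ by fun_prop) (ha.summable_momentTerm le_rfl hω)
      fun k θ ↦ (ha.norm_momentTerm_mul_cexp (-1) θ k).le
  have hlog : logChar a ω = fun θ ↦ _ := funext fun θ ↦ (ha.hasSum_logChar hω θ).tsum_eq
  rw [hlog]
  fun_prop

theorem norm_logChar_add_le (ha : IsAdmissible a s) (hω : 0 < ω) (θ : ℝ) :
    ‖logChar a ω θ + moment a 1 ω * θ ^ 2 / 2‖ ≤ 4 * |θ| ^ 3 * moment a 2 ω := by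
  have hsum := (ha.hasSum_logChar hω θ).summable.hasSum.add
    ((ha.hasSum_ofReal_moment (m := 1) (by norm_num) hω).mul_right ((θ : ℂ) ^ 2 / 2))
  have hbound := (ha.summable_momentTerm (m := 2) (by norm_num) hω).hasSum.mul_left (4 * |θ| ^ 3)
  rw [mul_div_assoc, logChar, ← hsum.tsum_eq]
  refine tsum_of_norm_bounded hbound fun k ↦ ?_
  have hzero := natCast_mul_momentTerm ha.map_zero (-1) ω k
  have hone := natCast_mul_momentTerm ha.map_zero 0 ω k
  have htwo := natCast_mul_momentTerm ha.map_zero 1 ω k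
  norm_num only at hzero hone htwo
  have hterm : (momentTerm a (-1) ω k : ℂ) * (Complex.exp (k * θ * I) - 1 - k * θ * I) +
      momentTerm a 1 ω k * ((θ : ℂ) ^ 2 / 2) = momentTerm a (-1) ω k *
        (Complex.exp ((k * θ : ℝ) * I) - 1 - (k * θ : ℝ) * I + ((k * θ : ℝ) : ℂ) ^ 2 / 2) := by
    rw [← hone, ← hzero]
    push_cast
    ring
  rw [hterm, norm_mul, Complex.norm_real, Real.norm_of_nonneg (ha.momentTerm_nonneg k)]
  calc momentTerm a (-1) ω k * _ ≤ momentTerm a (-1) ω k * (4 * |k * θ| ^ 3) :=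
        mul_le_mul_of_nonneg_left (norm_cexp_mul_I_sub_taylor_le _) (ha.momentTerm_nonneg k)
    _ = 4 * |θ| ^ 3 * momentTerm a 2 ω k := by
        rw [← htwo, ← hone, ← hzero, abs_mul, Nat.abs_cast]
        ring

theorem pow_le_momentTerm_neg_one (ha : IsAdmissible a s) {k : ℕ} (hk : 0 < k) :
    Real.exp (-1 / ω) ^ k ≤ momentTerm a (-1) ω k := by
  rw [momentTerm, zpow_neg_one, ← div_eq_mul_inv, ← exp_neg_natCast_div]
  exact le_mul_of_one_le_left (Real.exp_pos _).le
    ((one_le_div (Nat.cast_pos.2 hk)).2 (ha.natCast_le k))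

theorem hasSum_re_logChar (ha : IsAdmissible a s) (hω : 0 < ω) (θ : ℝ) :
    HasSum (fun k : ℕ ↦ momentTerm a (-1) ω k * (1 - Real.cos (k * θ))) (-(logChar a ω θ).re) := by
  have hterm (k : ℕ) : momentTerm a (-1) ω k * (1 - Real.cos (k * θ)) =
      -((momentTerm a (-1) ω k : ℂ) * (Complex.exp (k * θ * I) - 1 - k * θ * I)).re := by
    have hcast : (k * θ * I : ℂ) = ((k * θ : ℝ) : ℂ) * I := by push_cast; ring
    rw [Complex.re_ofReal_mul, hcast, Complex.sub_re, Complex.sub_re, Complex.exp_ofReal_mul_I_re,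
      Complex.re_ofReal_mul, Complex.I_re, Complex.one_re]
    ring
  simp only [hterm]
  exact (Complex.hasSum_re (ha.hasSum_logChar hω θ).summable.hasSum).neg

theorem re_logChar_le (ha : IsAdmissible a s) (hω : 0 < ω) (θ : ℝ) :
    (logChar a ω θ).re ≤ -(Real.exp (-1 / ω) * (1 + Real.exp (-1 / ω)) * (1 - Real.cos θ) /
      ((1 - Real.exp (-1 / ω)) *
        ((1 - Real.exp (-1 / ω)) ^ 2 + 2 * Real.exp (-1 / ω) * (1 - Real.cos θ)))) := by
  rw [le_neg]
  refine hasSum_le (fun k ↦ ?_)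
    (hasSum_pow_mul_one_sub_cos (Real.exp_pos _) (exp_neg_one_div_lt_one hω) θ)
    (ha.hasSum_re_logChar hω θ)
  rcases Nat.eq_zero_or_pos k with rfl | hk
  · simp
  · exact mul_le_mul_of_nonneg_right (ha.pow_le_momentTerm_neg_one hk)
      (sub_nonneg.2 (Real.cos_le_one _))

theorem re_logChar_le_of_le_one_sub_cos (ha : IsAdmissible a s) {τ θ : ℝ} (hω : 2 ≤ ω)
    (hτ0 : 0 ≤ τ) (hτ : τ ≤ (1 / ω) ^ 2) (hθ : τ ≤ 1 - Real.cos θ) :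
    (logChar a ω θ).re ≤ -(τ * ω ^ 3 / 4) := by
  have hω0 : 0 < ω := by linarith
  refine (ha.re_logChar_le hω0 θ).trans (neg_le_neg ?_)
  have hq := half_le_exp_neg_one_div hω
  have hr0 : 0 < 1 - Real.exp (-1 / ω) := sub_pos.2 (exp_neg_one_div_lt_one hω0)
  have hr := one_sub_exp_neg_one_div_le ω
  generalize Real.exp (-1 / ω) = q at hq hr0 hr
  generalize 1 - Real.cos θ = t at hθ
  have hcube : ω ^ 3 = 1 / (1 / ω) ^ 3 := by field_simp
  have hinv : 0 < 1 / ω := by positivity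
  generalize 1 / ω = r at hτ hr hcube hinv
  have ht : 0 ≤ t := hτ0.trans hθ
  have hden : (1 - q) * ((1 - q) ^ 2 + 2 * q * t) ≤ r * (r ^ 2 + 2 * t) := by
    have : 2 * q * t ≤ 2 * t := by nlinarith
    gcongr
  have hnum : 3 / 4 ≤ q * (1 + q) := by nlinarith
  calc τ * ω ^ 3 / 4 = τ / (4 * r ^ 3) := by rw [hcube]; field_simp
    _ ≤ 3 / 4 * t / (r * (r ^ 2 + 2 * t)) := by
      rw [div_le_div_iff₀ (by positivity) (by positivity)]
      have : τ * (r ^ 2 + 2 * t) ≤ 3 * t * r ^ 2 := by nlinarith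
      nlinarith
    _ ≤ q * (1 + q) * t / ((1 - q) * ((1 - q) ^ 2 + 2 * q * t)) :=
      div_le_div₀ (by positivity) (by gcongr) (by positivity) hden

end IsAdmissible

/-! ### The Cauchy integral along the saddle point circle -/

namespace IsAdmissible

variable {a : ℕ → ℝ} {s ω : ℝ}

theorem summable_norm_div_mul_pow (ha : IsAdmissible a s) {ρ : ℝ} (hρ0 : 0 < ρ) (hρ1 : ρ < 1) :
    Summable fun k : ℕ ↦ ‖(a k / k : ℂ)‖ * ρ ^ k := by
  have hω : 0 < -1 / Real.log ρ := div_pos_of_neg_of_neg (by norm_num) (Real.log_neg hρ0 hρ1)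
  refine (ha.summable_momentTerm le_rfl hω).congr fun k ↦ ?_
  rw [momentTerm, zpow_neg_one, exp_neg_natCast_div, div_div_cancel₀ (by norm_num),
    Real.exp_log hρ0, norm_div, Complex.norm_real, Complex.norm_natCast,
    Real.norm_of_nonneg (ha.nonneg k), div_eq_mul_inv]

theorem tsum_div_mul_circleMap_pow_eq (ha : IsAdmissible a s) (hω : 0 < ω) (θ : ℝ) :
    ∑' k : ℕ, (a k / k : ℂ) * circleMap 0 (Real.exp (-1 / ω)) θ ^ k =
      moment a (-1) ω + logChar a ω θ + moment a 0 ω * (θ * I) := by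
  rw [logChar, (ha.hasSum_logChar hω θ).tsum_eq, add_sub, sub_add_cancel, add_sub_cancel]
  refine tsum_congr fun k ↦ ?_
  rw [momentTerm, zpow_neg_one, exp_neg_natCast_div, circleMap_zero, mul_pow,
    ← Complex.exp_nat_mul]
  push_cast
  ring_nf

theorem mul_exp_eq_integral (ha : IsAdmissible a s) {b : ℕ → ℝ} (hb0 : b 0 = 1)
    (hb : ∀ n : ℕ, n * b n = ∑ k ∈ Finset.Icc 1 n, a k * b (n - k)) (hω : 0 < ω) {n : ℕ}
    (hn : moment a 0 ω = n) :
    (2 * π * (b n * Real.exp (-n / ω)) : ℂ) =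
      Complex.exp (moment a (-1) ω) * ∫ θ in -π..π, Complex.exp (logChar a ω θ) := by
  have hrec (n : ℕ) : ((n + 1) * b (n + 1) : ℂ) =
      ∑ i ∈ Finset.range (n + 1), (i + 1) * ((a (i + 1) : ℂ) / (i + 1 : ℕ)) * (b (n - i) : ℂ) := by
    have h := hb (n + 1)
    rw [← Finset.Ico_add_one_right_eq_Icc, Finset.sum_Ico_eq_sum_range] at h
    have hcast := congrArg ((↑) : ℝ → ℂ) h
    push_cast at hcast ⊢
    rw [hcast]
    refine Finset.sum_congr rfl fun i _ ↦ ?_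
    have hi : (i + 1 : ℂ) ≠ 0 := by exact_mod_cast i.succ_ne_zero
    rw [mul_div_cancel₀ _ hi, add_comm 1 i, Nat.add_sub_add_right]
  have hcauchy := integral_cexp_tsum_eq (c := fun k ↦ (a k / k : ℂ)) (b := fun k ↦ (b k : ℂ))
    (fun ρ ↦ ha.summable_norm_div_mul_pow) (by simp [hb0]) hrec (Real.exp_pos (-1 / ω))
    (exp_neg_one_div_lt_one hω) n
  have hintegrand (θ : ℝ) : Complex.exp (moment a (-1) ω + logChar a ω θ +
      moment a 0 ω * (θ * I)) * Complex.exp (-(n * θ * I)) =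
        Complex.exp (moment a (-1) ω) * Complex.exp (logChar a ω θ) := by
    rw [← Complex.exp_add, ← Complex.exp_add, hn, Complex.ofReal_natCast]
    ring_nf
  simp only [ha.tsum_div_mul_circleMap_pow_eq hω, hintegrand,
    intervalIntegral.integral_const_mul] at hcauchy
  rw [hcauchy, exp_neg_natCast_div]
  push_cast
  ring

end IsAdmissible

/-! ### The main arc -/

/-- Half the angular width of the main arc: for `|θ| ≤ arcWidth a ω` the cubic Taylor remainder of
`logChar a ω θ` is at most half of its quadratic term. -/
noncomputable def arcWidth (a : ℕ → ℝ) (ω : ℝ) : ℝ := moment a 1 ω / (16 * moment a 2 ω)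

theorem integral_cexp_neg_half_mul_sq :
    ∫ u : ℝ, Complex.exp ((-(1 / 2) * u ^ 2 : ℝ)) = √(2 * π) := by
  simp only [← Complex.ofReal_exp]
  rw [integral_complex_ofReal, integral_gaussian, div_div_eq_mul_div, div_one, mul_comm]

namespace IsAdmissible

variable {a : ℕ → ℝ} {s ω : ℝ}

theorem arcWidth_pos (ha : IsAdmissible a s) (hω : 0 < ω) : 0 < arcWidth a ω :=
  div_pos (ha.moment_pos (by norm_num) hω)
    (mul_pos (by norm_num) (ha.moment_pos (by norm_num) hω))

theorem arcWidth_le_one (ha : IsAdmissible a s) (hω : 0 < ω) : arcWidth a ω ≤ 1 := by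
  have hpos : 0 < moment a 2 ω := ha.moment_pos (by norm_num) hω
  have hle : moment a 1 ω ≤ moment a 2 ω := ha.moment_le_moment_add_one (by norm_num) hω
  rw [arcWidth, div_le_one (by positivity)]
  linarith

theorem exists_le_arcWidth (ha : IsAdmissible a s) :
    ∃ c > 0, c ≤ 1 ∧ ∀ ω ≥ 2, c * ω ^ (1 - s) ≤ arcWidth a ω := by
  obtain ⟨C, hC0, hC⟩ := ha.exists_moment_le (m := 2) (by norm_num)
  refine ⟨min 1 (1 / (32 * C)), by positivity, min_le_left _ _, fun ω hω ↦ ?_⟩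
  have hω0 : 0 < ω := by linarith
  have hpos : 0 < moment a 2 ω := ha.moment_pos (by norm_num) hω0
  have hpow : ω ^ (1 - s) * ω ^ ((2 : ℤ) + s : ℝ) = ω ^ 3 := by
    rw [← Real.rpow_add hω0, ← Real.rpow_natCast]
    norm_num
  rw [arcWidth, le_div_iff₀ (by positivity)]
  calc min 1 (1 / (32 * C)) * ω ^ (1 - s) * (16 * moment a 2 ω)
      ≤ 1 / (32 * C) * ω ^ (1 - s) * (16 * (C * ω ^ ((2 : ℤ) + s : ℝ))) := by
        gcongr
        · exact min_le_right _ _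
        · exact hC ω hω0
    _ = ω ^ (1 - s) * ω ^ ((2 : ℤ) + s : ℝ) / 2 := by
        field_simp
        ring
    _ ≤ moment a 1 ω := by
        rw [hpow]
        exact ha.cube_div_two_le_moment_one hω

theorem rpow_div_two_le_sqrt_moment_one (ha : IsAdmissible a s) (hω : 2 ≤ ω) :
    ω ^ (3 / 2 : ℝ) / 2 ≤ √(moment a 1 ω) := by
  have hω0 : 0 < ω := by linarith
  refine Real.le_sqrt_of_sq_le ?_
  have hsq : (ω ^ (3 / 2 : ℝ)) ^ 2 = ω ^ 3 := by
    rw [← Real.rpow_natCast, ← Real.rpow_mul hω0.le, ← Real.rpow_natCast]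
    norm_num
  have hcube : 0 < ω ^ 3 := by positivity
  rw [div_pow, hsq]
  linarith [ha.cube_div_two_le_moment_one hω]

theorem tendsto_sqrt_mul_arcWidth (ha : IsAdmissible a s) (hs : s < 5 / 2) :
    Tendsto (fun ω ↦ √(moment a 1 ω) * arcWidth a ω) atTop atTop := by
  obtain ⟨c, hc0, -, hc⟩ := ha.exists_le_arcWidth
  have hlower : Tendsto (fun ω : ℝ ↦ c / 2 * ω ^ (5 / 2 - s)) atTop atTop :=
    (tendsto_rpow_atTop (by linarith)).const_mul_atTop (by positivity)
  refine tendsto_atTop_mono' _ ?_ hlower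
  filter_upwards [eventually_ge_atTop 2] with ω hω
  have hω0 : 0 < ω := by linarith
  calc c / 2 * ω ^ (5 / 2 - s) = ω ^ (3 / 2 : ℝ) / 2 * (c * ω ^ (1 - s)) := by
        rw [show (5 / 2 - s : ℝ) = 3 / 2 + (1 - s) by ring, Real.rpow_add hω0]
        ring
    _ ≤ √(moment a 1 ω) * arcWidth a ω := by
        gcongr
        · exact ha.rpow_div_two_le_sqrt_moment_one hω
        · exact hc ω hω

theorem re_logChar_le_of_abs_le (ha : IsAdmissible a s) (hω : 0 < ω) {θ : ℝ}
    (hθ : |θ| ≤ arcWidth a ω) : (logChar a ω θ).re ≤ -(moment a 1 ω * θ ^ 2 / 4) := by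
  have hpos : 0 < moment a 2 ω := ha.moment_pos (by norm_num) hω
  have hremainder : 4 * |θ| ^ 3 * moment a 2 ω ≤ moment a 1 ω * θ ^ 2 / 4 := by
    rw [arcWidth, le_div_iff₀ (by positivity)] at hθ
    calc 4 * |θ| ^ 3 * moment a 2 ω = |θ| * (16 * moment a 2 ω) * |θ| ^ 2 / 4 := by ring
      _ ≤ moment a 1 ω * |θ| ^ 2 / 4 := by gcongr
      _ = moment a 1 ω * θ ^ 2 / 4 := by rw [sq_abs]
  have hre := (Complex.re_le_norm _).trans (ha.norm_logChar_add_le hω θ)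
  have hquad : (moment a 1 ω * θ ^ 2 / 2 : ℂ) = (moment a 1 ω * θ ^ 2 / 2 : ℝ) := by norm_cast
  rw [hquad, Complex.add_re, Complex.ofReal_re] at hre
  linarith

theorem norm_logChar_div_sqrt_sub_le (ha : IsAdmissible a s) (hω : 0 < ω) (u : ℝ) :
    ‖logChar a ω (u / √(moment a 1 ω)) - (-(1 / 2) * u ^ 2 : ℝ)‖ ≤
      |u| ^ 3 / 4 * (√(moment a 1 ω) * arcWidth a ω)⁻¹ := by
  have hone : 0 < moment a 1 ω := ha.moment_pos (by norm_num) hω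
  have htwo : 0 < moment a 2 ω := ha.moment_pos (by norm_num) hω
  have hsqrt : 0 < √(moment a 1 ω) := Real.sqrt_pos.2 hone
  have hsq : √(moment a 1 ω) ^ 2 = moment a 1 ω := Real.sq_sqrt hone.le
  have hquad : (moment a 1 ω : ℂ) * ((u / √(moment a 1 ω) : ℝ) : ℂ) ^ 2 / 2 =
      -((-(1 / 2) * u ^ 2 : ℝ) : ℂ) := by
    have hne : (moment a 1 ω : ℂ) ≠ 0 := by exact_mod_cast hone.ne'
    rw [← Complex.ofReal_pow, div_pow, hsq]
    push_cast
    field_simp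
  have htaylor := ha.norm_logChar_add_le hω (u / √(moment a 1 ω))
  rw [hquad, ← sub_eq_add_neg] at htaylor
  refine htaylor.trans_eq ?_
  rw [abs_div, abs_of_pos hsqrt, div_pow, pow_succ (√(moment a 1 ω)), hsq, arcWidth]
  field_simp
  ring

theorem tendsto_logChar_div_sqrt (ha : IsAdmissible a s) (hs : s < 5 / 2) (u : ℝ) :
    Tendsto (fun ω ↦ logChar a ω (u / √(moment a 1 ω))) atTop (𝓝 (-(1 / 2) * u ^ 2 : ℝ)) := by
  rw [tendsto_iff_norm_sub_tendsto_zero]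
  have hbound : Tendsto (fun ω ↦ |u| ^ 3 / 4 * (√(moment a 1 ω) * arcWidth a ω)⁻¹) atTop (𝓝 0) := by
    simpa only [mul_zero, Pi.inv_apply] using
      (ha.tendsto_sqrt_mul_arcWidth hs).inv_tendsto_atTop.const_mul (|u| ^ 3 / 4)
  refine squeeze_zero' (.of_forall fun _ ↦ norm_nonneg _) ?_ hbound
  filter_upwards [eventually_gt_atTop 0] with ω hω using ha.norm_logChar_div_sqrt_sub_le hω u

theorem norm_cexp_logChar_div_sqrt_le (ha : IsAdmissible a s) (hω : 0 < ω) {u : ℝ}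
    (hu : |u| ≤ √(moment a 1 ω) * arcWidth a ω) :
    ‖Complex.exp (logChar a ω (u / √(moment a 1 ω)))‖ ≤ Real.exp (-(1 / 4) * u ^ 2) := by
  have hone : 0 < moment a 1 ω := ha.moment_pos (by norm_num) hω
  have hsqrt : 0 < √(moment a 1 ω) := Real.sqrt_pos.2 hone
  have hθ : |u / √(moment a 1 ω)| ≤ arcWidth a ω := by
    rwa [abs_div, abs_of_pos hsqrt, div_le_iff₀' hsqrt]
  rw [Complex.norm_exp, Real.exp_le_exp]
  refine (ha.re_logChar_le_of_abs_le hω hθ).trans_eq ?_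
  rw [div_pow, Real.sq_sqrt hone.le]
  field_simp

theorem tendsto_integral_indicator_cexp_logChar (ha : IsAdmissible a s) (hs : s < 5 / 2) :
    Tendsto (fun ω ↦ ∫ u : ℝ,
      (Set.Ioc (-(√(moment a 1 ω) * arcWidth a ω)) (√(moment a 1 ω) * arcWidth a ω)).indicator
        (fun u ↦ Complex.exp (logChar a ω (u / √(moment a 1 ω)))) u) atTop (𝓝 √(2 * π)) := by
  rw [← integral_cexp_neg_half_mul_sq]
  refine MeasureTheory.tendsto_integral_filter_of_dominated_convergence
    (fun u ↦ Real.exp (-(1 / 4) * u ^ 2)) ?_ ?_ (integrable_exp_neg_mul_sq (by norm_num))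
    (.of_forall fun u ↦ ?_)
  · filter_upwards [eventually_gt_atTop 0] with ω hω
    have := ha.continuous_logChar hω
    exact (Continuous.aestronglyMeasurable (by fun_prop)).indicator measurableSet_Ioc
  · filter_upwards [eventually_gt_atTop 0] with ω hω
    refine .of_forall fun u ↦ ?_
    rw [norm_indicator_eq_indicator_norm]
    refine Set.indicator_apply_le' (fun hu ↦ ?_) fun _ ↦ (Real.exp_pos _).le
    exact ha.norm_cexp_logChar_div_sqrt_le hω (abs_le.2 ⟨hu.1.le, hu.2⟩)
  · have hexp := (Complex.continuous_exp.tendsto _).comp (ha.tendsto_logChar_div_sqrt hs u)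
    refine hexp.congr' ?_
    filter_upwards [(ha.tendsto_sqrt_mul_arcWidth hs).eventually_gt_atTop |u|] with ω hω
    have hu : u ∈ Set.Ioc (-(√(moment a 1 ω) * arcWidth a ω)) (√(moment a 1 ω) * arcWidth a ω) :=
      ⟨(abs_lt.1 hω).1, (abs_lt.1 hω).2.le⟩
    rw [Set.indicator_of_mem hu, Function.comp_apply]

theorem tendsto_integral_main_arc (ha : IsAdmissible a s) (hs : s < 5 / 2) :
    Tendsto (fun ω ↦ (√(moment a 1 ω) : ℂ) *
      ∫ θ in -arcWidth a ω..arcWidth a ω, Complex.exp (logChar a ω θ)) atTop (𝓝 √(2 * π)) := by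
  refine (ha.tendsto_integral_indicator_cexp_logChar hs).congr' ?_
  filter_upwards [eventually_gt_atTop 0] with ω hω
  have hsqrt : 0 < √(moment a 1 ω) := Real.sqrt_pos.2 (ha.moment_pos (by norm_num) hω)
  have hwidth := ha.arcWidth_pos hω
  rw [MeasureTheory.integral_indicator measurableSet_Ioc,
    ← intervalIntegral.integral_of_le (neg_le_self (by positivity)),
    intervalIntegral.integral_comp_div (fun θ ↦ Complex.exp (logChar a ω θ)) hsqrt.ne', neg_div,
    mul_div_cancel_left₀ _ hsqrt.ne', Complex.real_smul]

end IsAdmissible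

/-! ### The minor arcs -/

theorem norm_integral_sub_integral_le {E : Type*} [NormedAddCommGroup E] [NormedSpace ℝ E]
    {f : ℝ → E} (hf : Continuous f) {δ L M : ℝ} (hδ : 0 ≤ δ) (hδL : δ ≤ L)
    (hM : ∀ θ, δ ≤ |θ| → |θ| ≤ L → ‖f θ‖ ≤ M) :
    ‖(∫ θ in -L..L, f θ) - ∫ θ in -δ..δ, f θ‖ ≤ 2 * L * M := by
  have hM0 : 0 ≤ M := (norm_nonneg _).trans
    (hM L (hδL.trans (le_abs_self L)) (abs_of_nonneg (hδ.trans hδL)).le)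
  have hleft : ‖∫ θ in -L..-δ, f θ‖ ≤ M * |-δ - -L| := by
    refine intervalIntegral.norm_integral_le_of_norm_le_const fun θ hθ ↦ ?_
    rw [Set.uIoc_of_le (by linarith)] at hθ
    have habs : |θ| = -θ := abs_of_nonpos (by linarith [hθ.2])
    exact hM θ (by linarith [hθ.2]) (by linarith [hθ.1])
  have hright : ‖∫ θ in δ..L, f θ‖ ≤ M * |L - δ| := by
    refine intervalIntegral.norm_integral_le_of_norm_le_const fun θ hθ ↦ ?_
    rw [Set.uIoc_of_le hδL] at hθ
    have habs : |θ| = θ := abs_of_nonneg (by linarith [hθ.1])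
    exact hM θ (by linarith [hθ.1]) (by linarith [hθ.2])
  rw [abs_of_nonneg (by linarith)] at hleft hright
  have hintegrable (x y : ℝ) := hf.intervalIntegrable (μ := MeasureTheory.volume) x y
  rw [← intervalIntegral.integral_add_adjacent_intervals (hintegrable (-L) (-δ))
      (hintegrable (-δ) L),
    ← intervalIntegral.integral_add_adjacent_intervals (hintegrable (-δ) δ) (hintegrable δ L),
    add_sub_assoc, add_sub_cancel_left]
  refine (norm_add_le_of_le hleft hright).trans ?_
  nlinarith

theorem sq_div_five_le_one_sub_cos {θ : ℝ} (hθ : |θ| ≤ π) : θ ^ 2 / 5 ≤ 1 - Real.cos θ := by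
  have hπ : 1 / 5 ≤ 2 / π ^ 2 := by
    rw [div_le_div_iff₀ (by norm_num) (by positivity)]
    nlinarith [Real.pi_lt_d2, Real.pi_pos]
  have hcos := Real.cos_le_one_sub_mul_cos_sq hθ
  have hsq : 1 / 5 * θ ^ 2 ≤ 2 / π ^ 2 * θ ^ 2 := by gcongr
  linarith

namespace IsAdmissible

variable {a : ℕ → ℝ} {s ω : ℝ}

theorem exists_norm_cexp_logChar_le (ha : IsAdmissible a s) :
    ∃ c > 0, ∀ ω ≥ 2, ∀ θ, arcWidth a ω ≤ |θ| → |θ| ≤ π →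
      ‖Complex.exp (logChar a ω θ)‖ ≤ Real.exp (-c * ω ^ (5 - 2 * s)) := by
  obtain ⟨c, hc0, hc1, hc⟩ := ha.exists_le_arcWidth
  refine ⟨c ^ 2 / 20, by positivity, fun ω hω θ hθ hθπ ↦ ?_⟩
  have hω0 : 0 < ω := by linarith
  have hτ : (c * ω ^ (1 - s)) ^ 2 / 5 ≤ (1 / ω) ^ 2 := by
    have hle : c * ω ^ (1 - s) ≤ 1 * ω ^ (-1 : ℝ) := by
      gcongr
      · linarith
      · linarith [ha.two_lt]
    rw [one_mul, Real.rpow_neg_one, ← one_div] at hle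
    have hsq : (c * ω ^ (1 - s)) ^ 2 ≤ (1 / ω) ^ 2 := by gcongr
    linarith [sq_nonneg (c * ω ^ (1 - s))]
  have hcos : (c * ω ^ (1 - s)) ^ 2 / 5 ≤ 1 - Real.cos θ := by
    refine le_trans ?_ (sq_div_five_le_one_sub_cos hθπ)
    rw [← sq_abs θ]
    gcongr
    exact (hc ω hω).trans hθ
  have hpow : ω ^ (5 - 2 * s) = (ω ^ (1 - s)) ^ 2 * ω ^ 3 := by
    rw [← Real.rpow_natCast, ← Real.rpow_mul hω0.le, ← Real.rpow_natCast, ← Real.rpow_add hω0]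
    congr 1
    push_cast
    ring
  rw [Complex.norm_exp, Real.exp_le_exp, hpow]
  refine (ha.re_logChar_le_of_le_one_sub_cos hω (by positivity) hτ hcos).trans_eq ?_
  ring

theorem exists_norm_sqrt_mul_integral_sub_le (ha : IsAdmissible a s) :
    ∃ c > 0, ∃ C, ∀ ω ≥ 2, ‖(√(moment a 1 ω) : ℂ) *
      ((∫ θ in -π..π, Complex.exp (logChar a ω θ)) -
        ∫ θ in -arcWidth a ω..arcWidth a ω, Complex.exp (logChar a ω θ))‖ ≤
      C * (ω ^ (1 + s) * Real.exp (-c * ω ^ (5 - 2 * s))) := by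
  obtain ⟨c, hc0, hc⟩ := ha.exists_norm_cexp_logChar_le
  obtain ⟨C, hC0, hC⟩ := ha.exists_moment_le (m := 1) (by norm_num)
  refine ⟨c, hc0, C * (2 * π), fun ω hω ↦ ?_⟩
  have hω0 : 0 < ω := by linarith
  have hone : 1 ≤ moment a 1 ω := by
    have hcube : (2 : ℝ) ^ 3 ≤ ω ^ 3 := by gcongr
    linarith [ha.cube_div_two_le_moment_one hω]
  have hsqrt : √(moment a 1 ω) ≤ C * ω ^ (1 + s) := by
    have hle := (Real.sqrt_le_self_iff.2 (.inr hone)).trans (hC ω hω0)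
    rwa [Int.cast_one] at hle
  have harc := norm_integral_sub_integral_le (ha.continuous_logChar hω0).cexp
    (ha.arcWidth_pos hω0).le ((ha.arcWidth_le_one hω0).trans (by linarith [Real.pi_gt_three]))
    (hc ω hω)
  rw [norm_mul, Complex.norm_real, Real.norm_of_nonneg (Real.sqrt_nonneg _)]
  calc √(moment a 1 ω) * _ ≤ C * ω ^ (1 + s) * (2 * π * Real.exp (-c * ω ^ (5 - 2 * s))) := by
        gcongr
    _ = C * (2 * π) * (ω ^ (1 + s) * Real.exp (-c * ω ^ (5 - 2 * s))) := by ring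

theorem tendsto_sqrt_mul_integral_cexp_logChar (ha : IsAdmissible a s) (hs : s < 5 / 2) :
    Tendsto (fun ω ↦ (√(moment a 1 ω) : ℂ) * ∫ θ in -π..π, Complex.exp (logChar a ω θ))
      atTop (𝓝 √(2 * π)) := by
  obtain ⟨c, hc0, C, hC⟩ := ha.exists_norm_sqrt_mul_integral_sub_le
  have hexponent : 0 < 5 - 2 * s := by linarith
  have hdecay : Tendsto (fun ω : ℝ ↦ C * (ω ^ (1 + s) * Real.exp (-c * ω ^ (5 - 2 * s))))
      atTop (𝓝 0) := by
    have h := ((tendsto_rpow_mul_exp_neg_mul_atTop_nhds_zero ((1 + s) / (5 - 2 * s)) c hc0).comp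
      (tendsto_rpow_atTop hexponent)).const_mul C
    rw [mul_zero] at h
    refine h.congr' ?_
    filter_upwards [eventually_ge_atTop 0] with ω hω
    rw [Function.comp_apply, ← Real.rpow_mul hω, mul_div_cancel₀ _ hexponent.ne']
  have hminor := squeeze_zero_norm'
    ((eventually_ge_atTop 2).mono fun ω hω ↦ hC ω hω) hdecay
  have hsum := hminor.add (ha.tendsto_integral_main_arc hs)
  rw [zero_add] at hsum
  exact hsum.congr fun ω ↦ by ring

theorem tendsto_div (ha : IsAdmissible a s) (hs : s < 5 / 2) {b : ℕ → ℝ} (hb0 : b 0 = 1)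
    (hb : ∀ n : ℕ, n * b n = ∑ k ∈ Finset.Icc 1 n, a k * b (n - k)) {ω : ℕ → ℝ}
    (h : ∀ n : ℕ, 1 ≤ n → 0 < ω n ∧ moment a 0 (ω n) = n) :
    Tendsto (fun n ↦ b n / (1 / √(2 * π * moment a 1 (ω n)) *
      Real.exp (moment a (-1) (ω n) + n / ω n))) atTop (𝓝 1) := by
  have hπ : 0 < √(2 * π) := Real.sqrt_pos.2 Real.two_pi_pos
  have hlim := ((ha.tendsto_sqrt_mul_integral_cexp_logChar hs).comp
    (ha.tendsto_atTop_of_moment_zero_eq h)).const_mul (√(2 * π) : ℂ)⁻¹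
  rw [inv_mul_cancel₀ (by exact_mod_cast hπ.ne')] at hlim
  have hre := (Complex.continuous_re.tendsto _).comp hlim
  rw [Complex.one_re] at hre
  refine hre.congr' ?_
  filter_upwards [eventually_ge_atTop 1] with n hn
  obtain ⟨hω, hmoment⟩ := h n hn
  have hone : 0 < √(moment a 1 (ω n)) := Real.sqrt_pos.2 (ha.moment_pos (by norm_num) hω)
  have hintegral : ∫ θ in -π..π, Complex.exp (logChar a (ω n) θ) =
      (2 * π * (b n * Real.exp (-n / ω n)) / Real.exp (moment a (-1) (ω n)) : ℝ) := by
    push_cast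
    rw [eq_div_iff (Complex.exp_ne_zero _), mul_comm,
      ← ha.mul_exp_eq_integral hb0 hb hω hmoment]
    push_cast
    rfl
  have hsqrt : √(2 * π) ^ 2 = 2 * π := Real.sq_sqrt Real.two_pi_pos.le
  simp only [Function.comp_apply]
  rw [hintegral, ← Complex.ofReal_mul, ← Complex.ofReal_inv, ← Complex.ofReal_mul,
    Complex.ofReal_re, Real.sqrt_mul Real.two_pi_pos.le, Real.exp_add, neg_div, Real.exp_neg]
  generalize √(2 * π) = t at hπ hsqrt
  rw [← hsqrt]
  field_simp

end IsAdmissible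

/-! ### Multisets over a weighted alphabet -/

section WeightedMultisets

variable {α : Type*} {w : α → ℕ}

theorem isAdmissible_divisorWeight (hw : ∀ l ≠ 0, (w ⁻¹' {l}).Finite)
    (hne : ∀ l ≠ 0, ∃ x, w x = l) {σ : ℝ}
    (hsum : Summable fun l ↦ (levelCount w l : ℝ) * (l : ℝ) ^ (-σ)) :
    IsAdmissible (fun k ↦ (divisorWeight w k : ℝ)) (σ + 1) where
  map_zero := by simp [divisorWeight]
  natCast_le k := by exact_mod_cast le_divisorWeight hw hne k
  summable := by
    have hσ : 1 < σ := one_lt_of_summable_mul_rpow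
      (fun l hl ↦ by exact_mod_cast one_le_levelCount hw hne hl) hsum
    exact summable_divisorWeight_mul_rpow (by linarith) hsum

end WeightedMultisets

/-! ### Pairs of positive integers weighted by their product -/

/-- The weight of a letter `(v, w)` of a generalized partition. -/
def letterWeight (x : ℕ × ℕ) : ℕ := x.1 * x.2

theorem letterWeight_preimage_singleton {l : ℕ} (hl : l ≠ 0) :
    letterWeight ⁻¹' {l} = l.divisorsAntidiagonal := by
  ext x
  simp [letterWeight, hl]

theorem finite_letterWeight_preimage_singleton {l : ℕ} (hl : l ≠ 0) :
    (letterWeight ⁻¹' {l}).Finite := by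
  rw [letterWeight_preimage_singleton hl]
  exact Finset.finite_toSet _

theorem infinite_letterWeight_preimage_zero : (letterWeight ⁻¹' {0}).Infinite :=
  Set.infinite_of_injective_forall_mem (f := fun n : ℕ ↦ (0, n)) (Prod.mk_right_injective 0)
    fun n ↦ by simp [letterWeight]

theorem levelCount_letterWeight (l : ℕ) : levelCount letterWeight l = l.divisors.card := by
  rcases eq_or_ne l 0 with rfl | hl
  · rw [levelCount, infinite_letterWeight_preimage_zero.ncard, Nat.divisors_zero,
      Finset.card_empty]
  · rw [levelCount, letterWeight_preimage_singleton hl, Set.ncard_coe_finset,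
      ← Nat.map_div_right_divisors, Finset.card_map]

theorem ncard_multisetsOfWeight_letterWeight (n : ℕ) :
    (multisetsOfWeight letterWeight n).ncard = p n := by
  simp only [multisetsOfWeight, p, IsGenPartition, letterWeight, CanonicallyOrderedAdd.mul_pos]
  rfl

theorem momentTerm_divisorWeight_letterWeight (m : ℤ) (ω : ℝ) :
    momentTerm (fun k ↦ (divisorWeight letterWeight k : ℝ)) m ω = term m ω := by
  ext k
  simp only [momentTerm, term, divisorWeight, levelCount_letterWeight, Nat.cast_sum,
    Nat.cast_mul, Finset.sum_mul]

theorem moment_divisorWeight_letterWeight (m : ℤ) (ω : ℝ) :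
    moment (fun k ↦ (divisorWeight letterWeight k : ℝ)) m ω = S m ω := by
  rw [moment, momentTerm_divisorWeight_letterWeight, S]

theorem summable_levelCount_letterWeight_mul_rpow {σ : ℝ} (hσ : 1 < σ) :
    Summable fun l ↦ (levelCount letterWeight l : ℝ) * (l : ℝ) ^ (-σ) := by
  have h := summable_sum_divisors_mul_rpow (f := 1) hσ
    (by simpa only [Pi.one_apply, one_mul] using Real.summable_nat_rpow.2 (neg_lt_neg hσ))
  simpa only [levelCount_letterWeight, Pi.one_apply, Finset.sum_const, nsmul_one] using h

end GeneralizedPartition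

open GeneralizedPartition in
theorem mainTheorem7_general {α : Type*} {w : α → ℕ} (hw : ∀ l ≠ 0, (w ⁻¹' {l}).Finite)
    (hne : ∀ l ≠ 0, ∃ x, w x = l) {σ : ℝ} (hσ : σ < 3 / 2)
    (hsum : Summable fun l ↦ (levelCount w l : ℝ) * (l : ℝ) ^ (-σ)) :
    (∀ m : ℤ, -1 ≤ m → ∀ ω : ℝ, 0 < ω →
      Summable (momentTerm (fun k ↦ (divisorWeight w k : ℝ)) m ω)) ∧
    (∀ n : ℕ, 1 ≤ n → ∃! ω : ℝ, 0 < ω ∧ moment (fun k ↦ (divisorWeight w k : ℝ)) 0 ω = n) ∧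
    (∀ ω : ℕ → ℝ,
      (∀ n : ℕ, 1 ≤ n → 0 < ω n ∧ moment (fun k ↦ (divisorWeight w k : ℝ)) 0 (ω n) = n) →
      Filter.Tendsto
        (fun n : ℕ ↦ ((multisetsOfWeight w n).ncard : ℝ) /
          (1 / √(2 * Real.pi * moment (fun k ↦ (divisorWeight w k : ℝ)) 1 (ω n)) *
            Real.exp (moment (fun k ↦ (divisorWeight w k : ℝ)) (-1) (ω n) + n / ω n)))
        Filter.atTop (nhds 1)) := by
  have ha := isAdmissible_divisorWeight hw hne hsum
  refine ⟨fun m hm ω hω ↦ ha.summable_momentTerm hm hω,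
    fun n hn ↦ ha.existsUnique_moment_zero_eq hn, fun ω hω ↦ ?_⟩
  refine ha.tendsto_div (b := fun n ↦ ((multisetsOfWeight w n).ncard : ℝ)) (by linarith) ?_
    (fun n ↦ ?_) hω
  · simp [multisetsOfWeight_zero]
  · exact_mod_cast mul_ncard_multisetsOfWeight hw n

theorem mainTheorem7 :
    -- the series `S_m(ω)` converge absolutely (their terms are nonnegative)
    (∀ m : ℤ, -1 ≤ m → ∀ ω : ℝ, 0 < ω → Summable (GeneralizedPartition.term m ω)) ∧
    -- `S_0(ω) = n` has a unique solution in `(0, ∞)`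
    (∀ n : ℕ, 1 ≤ n → ∃! ω : ℝ, 0 < ω ∧ GeneralizedPartition.S 0 ω = n) ∧
    -- the asymptotic formula at that solution
    (∀ ω : ℕ → ℝ, (∀ n : ℕ, 1 ≤ n → 0 < ω n ∧ GeneralizedPartition.S 0 (ω n) = n) →
      Filter.Tendsto
        (fun n : ℕ => (GeneralizedPartition.p n : ℝ) /
          (1 / Real.sqrt (2 * Real.pi * GeneralizedPartition.S 1 (ω n)) *
            Real.exp (GeneralizedPartition.S (-1) (ω n) + (n : ℝ) / ω n)))
        Filter.atTop (nhds 1)) := by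
  simpa only [GeneralizedPartition.momentTerm_divisorWeight_letterWeight,
    GeneralizedPartition.moment_divisorWeight_letterWeight,
    GeneralizedPartition.ncard_multisetsOfWeight_letterWeight] using
    mainTheorem7_general (fun l ↦ GeneralizedPartition.finite_letterWeight_preimage_singleton)
      (fun l _ ↦ ⟨(1, l), one_mul l⟩) (by norm_num : (5 / 4 : ℝ) < 3 / 2)
      (GeneralizedPartition.summable_levelCount_letterWeight_mul_rpow (by norm_num))
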